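/- A Köthe matrix is a matrix $A=(a_{j,q})_{j\in\mathbb N,q\in\mathbb N_0}$ of non-negative numbers such that $a_{j,q}\le a_{j,q+1}$ for all $j,q$ and for each $j$ there is $q$ with $a_{j,q}>0$. The Köthe space $\lambda^\infty(A)$ consists of all $\xi\in\mathbb C^{\mathbb N}$ with $|\xi|_{\infty,q}:=\sup_{j}|\xi_j|a_{j,q}<\infty$ for all $q\in\mathbb N_0$, with the locally convex topology given by the seminorms $|\cdot|_{\infty,q}$; if $\lambda^\infty(A)\subset c_0$, it is a Fréchet ${}^*$-algebra with pointwise multiplication and conjugation. For $\mathcal N\subset\mathbb N$ let $e_{\mathcal N}$ be the sequence which is $1$ on $\mathcal N$ and $0$ otherwise, and let $e_k:=e_{\{k\}}$. Let $A=(a_{j,q})$ be a Köthe matrix such that $\lambda^\infty(A)$ is nuclear and $\lambda^\infty(A)\subset c_0$. Let $E$ be an infinite-dimensional closed ${}^*$-subalgebra of $\lambda^\infty(A)$. Then there is a family $\{\mathcal N_k\}_{k\in\mathbb N}$ of finite nonempty pairwise disjoint subsets of $\mathbb N$ such that (i) $(e_{\mathcal N_k})_{k\in\mathbb N}$ is a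 Schauder basis of $E$; (ii) $E\cong\lambda^\infty\left(\max_{j\in\mathcal N_k}a_{j,q}\right)$ as Fréchet ${}^*$-algebras, where the matrix on the right has rows indexed by $k\in\mathbb N$ and columns indexed by $q\in\mathbb N_0$, by an isomorphism with $e_{\mathcal N_k}\mapsto e_k$ for all $k\in\mathbb N$. Conversely, if $\{\mathcal N_k\}_{k\in\mathbb N}$ is a family of finite nonempty pairwise disjoint subsets of $\mathbb N$ and $F$ is the closed ${}^*$-subalgebra of $\lambda^\infty(A)$ generated by $\{e_{\mathcal N_k}:k\in\mathbb N\}$, then (iii) $(e_{\mathcal N_k})_{k\in\mathbb N}$ is a Schauder basis of $F$; (iv) $F\cong\lambda^\infty\left(\max_{j\in\mathcal N_k}a_{j,q}\right)$ as Fréchet ${}^*$-algebras, by an isomorphism with $e_{\mathcal N_k}\mapsto e_k$ for all $k\in\mathbb N$. -/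

import Mathlib

open Filter Topology

noncomputable section

/-! ### Nuclear locally convex spaces -/

/-- The space `E` seminormed by the single seminorm `p`. Its completion (which is Hausdorff, so
that the kernel of `p` is divided out) is the local Banach space of `E` at `p`. -/
def Seminorm.LocalSpace {E : Type*} [AddCommGroup E] [Module ℂ E] (_p : Seminorm ℂ E) : Type _ := E

namespace Seminorm.LocalSpace

variable {E : Type*} [AddCommGroup E] [Module ℂ E] (p : Seminorm ℂ E)

instance : SeminormedAddCommGroup p.LocalSpace :=
  p.toAddGroupSeminorm.toSeminormedAddCommGroup

instance : NormedSpace ℂ p.LocalSpace :=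
  { (inferInstance : Module ℂ E) with
    norm_smul_le := fun c x => (map_smul_eq_mul p c x).le }

/-- The canonical map of `E` into its local Banach space at `p`. -/
def toBanach (x : E) : UniformSpace.Completion p.LocalSpace :=
  ((show p.LocalSpace from x : p.LocalSpace) : UniformSpace.Completion p.LocalSpace)

end Seminorm.LocalSpace

/-- A locally convex space `E` is nuclear if for every continuous seminorm `p` there is a
continuous seminorm `q ≥ p` such that the canonical map from the local Banach space at `q` to the
local Banach space at `p` is nuclear, i.e. of the form `x ↦ ∑ f n x • y n` with functionals `f n`
of `q`-norm at most `c n` and `∑ c n * ‖y n‖ < ∞`. -/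
def IsNuclearSpace (E : Type*) [AddCommGroup E] [Module ℂ E] [TopologicalSpace E] : Prop :=
  ∀ p : Seminorm ℂ E, Continuous p →
    ∃ q : Seminorm ℂ E, Continuous q ∧ p ≤ q ∧
      ∃ (f : ℕ → E →ₗ[ℂ] ℂ) (c : ℕ → NNReal) (y : ℕ → UniformSpace.Completion p.LocalSpace),
        (∀ n x, ‖f n x‖ ≤ c n * q x) ∧
        Summable (fun n => (c n : ℝ) * ‖y n‖) ∧
        ∀ x : E, HasSum (fun n => f n x • y n) (Seminorm.LocalSpace.toBanach p x)

/-! ### Schauder bases of topological vector spaces -/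

/-- `e` is a Schauder basis of `X`: every vector has a unique expansion as a convergent series
`∑ c k • e k`, and the coefficients depend continuously on the vector. -/
def IsSchauderBasis {X : Type*} [AddCommGroup X] [Module ℂ X] [TopologicalSpace X]
    (e : ℕ → X) : Prop :=
  (∀ x : X, ∃! c : ℕ → ℂ,
    Tendsto (fun n => ∑ k ∈ Finset.range n, c k • e k) atTop (𝓝 x)) ∧
  ∃ f : ℕ → X →L[ℂ] ℂ, ∀ x : X,
    Tendsto (fun n => ∑ k ∈ Finset.range n, f k x • e k) atTop (𝓝 x)

/-! ### Köthe matrices and Köthe spaces -/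

/-- A Köthe matrix `(a j q)`. -/
structure KoetheMatrix where
  a : ℕ → ℕ → ℝ
  nonneg : ∀ j q, 0 ≤ a j q
  exists_pos : ∀ j, ∃ q, 0 < a j q
  mono : ∀ j q, a j q ≤ a j (q + 1)

namespace KoetheMatrix

/-- The sequences `ξ` with `sup_j |ξ j| * a j q < ∞` for all `q`, as a set of sequences. -/
def submodule (A : KoetheMatrix) : Submodule ℂ (ℕ → ℂ) where
  carrier := {ξ | ∀ q, BddAbove (Set.range fun j => ‖ξ j‖ * A.a j q)}
  zero_mem' := fun q => ⟨0, by rintro _ ⟨j, rfl⟩; simp⟩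
  add_mem' := by
    intro ξ η hξ hη q
    obtain ⟨C, hC⟩ := hξ q
    obtain ⟨D, hD⟩ := hη q
    refine ⟨C + D, ?_⟩
    rintro _ ⟨j, rfl⟩
    have h1 : ‖ξ j‖ * A.a j q ≤ C := hC ⟨j, rfl⟩
    have h2 : ‖η j‖ * A.a j q ≤ D := hD ⟨j, rfl⟩
    have h3 := mul_le_mul_of_nonneg_right (norm_add_le (ξ j) (η j)) (A.nonneg j q)
    simp only [Pi.add_apply]
    linarith
  smul_mem' := by
    intro c ξ hξ q
    obtain ⟨C, hC⟩ := hξ q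
    refine ⟨‖c‖ * C, ?_⟩
    rintro _ ⟨j, rfl⟩
    have h1 : ‖ξ j‖ * A.a j q ≤ C := hC ⟨j, rfl⟩
    simp only [Pi.smul_apply, smul_eq_mul, norm_mul, mul_assoc]
    exact mul_le_mul_of_nonneg_left h1 (norm_nonneg c)

end KoetheMatrix

/-- The Köthe space `λ^∞(A)`. It is a type of its own, so that it does not inherit the topology of
pointwise convergence. -/
def KoetheSpace (A : KoetheMatrix) : Type := A.submodule

namespace KoetheSpace

variable {A : KoetheMatrix}

instance : AddCommGroup (KoetheSpace A) := inferInstanceAs (AddCommGroup A.submodule)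
instance : Module ℂ (KoetheSpace A) := inferInstanceAs (Module ℂ A.submodule)

instance : CoeFun (KoetheSpace A) (fun _ => ℕ → ℂ) := ⟨fun ξ => ξ.1⟩

/-- The seminorm `|ξ|_{∞,q} = sup_j |ξ j| * a j q`. -/
def seminorm (A : KoetheMatrix) (q : ℕ) : Seminorm ℂ (KoetheSpace A) :=
  Seminorm.of (fun ξ => ⨆ j, ‖ξ j‖ * A.a j q)
    (by
      intro ξ η
      refine ciSup_le fun j => ?_
      have h1 := le_ciSup (ξ.2 q) j
      have h2 := le_ciSup (η.2 q) j
      have h3 := mul_le_mul_of_nonneg_right (norm_add_le (ξ j) (η j)) (A.nonneg j q)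
      have h4 : ‖(ξ + η) j‖ * A.a j q = ‖ξ j + η j‖ * A.a j q := rfl
      linarith)
    (by
      intro c ξ
      rw [Real.mul_iSup_of_nonneg (norm_nonneg c)]
      refine iSup_congr fun j => ?_
      have h : (c • ξ) j = c * ξ j := rfl
      rw [h, norm_mul, mul_assoc])

/-- The locally convex topology given by the seminorms `|·|_{∞,q}`. -/
instance : TopologicalSpace (KoetheSpace A) :=
  SeminormFamily.moduleFilterBasis (seminorm A) |>.topology

theorem withSeminorms (A : KoetheMatrix) :
    WithSeminorms (E := KoetheSpace A) (seminorm A) := ⟨rfl⟩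

instance : IsTopologicalAddGroup (KoetheSpace A) := (withSeminorms A).topologicalAddGroup
instance : ContinuousSMul ℂ (KoetheSpace A) := (withSeminorms A).continuousSMul

/-- For a finite set `N`, the sequence `e_N` which is 1 on `N` and 0 otherwise. -/
def indicator (A : KoetheMatrix) (N : Finset ℕ) : KoetheSpace A :=
  ⟨fun j => if j ∈ N then 1 else 0, fun q => by
    refine ((N.finite_toSet.image fun j => A.a j q).union
      (Set.finite_singleton (0 : ℝ))).bddAbove.mono ?_
    rintro _ ⟨j, rfl⟩
    by_cases h : j ∈ N
    · exact Or.inl ⟨j, h, by simp [h]⟩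
    · exact Or.inr (by simp [h])⟩

end KoetheSpace

/-- `λ^∞(A) ⊆ c_0`. -/
class KoetheMatrix.SubsetC0 (A : KoetheMatrix) : Prop where
  tendsto_zero : ∀ ξ : KoetheSpace A, Tendsto ξ atTop (𝓝 0)

/-! ### Pointwise multiplication and conjugation on a Köthe space contained in `c_0` -/

namespace KoetheSpace

variable {A : KoetheMatrix}

theorem mul_mem [A.SubsetC0] (ξ η : KoetheSpace A) :
    (fun j => ξ j * η j) ∈ A.submodule := by
  intro q
  obtain ⟨C, hC⟩ := (KoetheMatrix.SubsetC0.tendsto_zero ξ).norm.bddAbove_range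
  obtain ⟨D, hD⟩ := η.2 q
  refine ⟨C * D, ?_⟩
  rintro _ ⟨j, rfl⟩
  have h1 : ‖ξ j‖ ≤ C := hC ⟨j, rfl⟩
  have h2 : ‖η j‖ * A.a j q ≤ D := hD ⟨j, rfl⟩
  simp only [norm_mul, mul_assoc]
  exact mul_le_mul h1 h2 (mul_nonneg (norm_nonneg _) (A.nonneg j q)) ((norm_nonneg _).trans h1)

instance [A.SubsetC0] : NonUnitalCommRing (KoetheSpace A) :=
  { (inferInstance : AddCommGroup (KoetheSpace A)) with
    mul := fun ξ η => ⟨fun j => ξ j * η j, mul_mem ξ η⟩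
    left_distrib := fun ξ η ζ => Subtype.ext (funext fun j => mul_add (ξ j) (η j) (ζ j))
    right_distrib := fun ξ η ζ => Subtype.ext (funext fun j => add_mul (ξ j) (η j) (ζ j))
    zero_mul := fun ξ => Subtype.ext (funext fun j => zero_mul (ξ j))
    mul_zero := fun ξ => Subtype.ext (funext fun j => mul_zero (ξ j))
    mul_assoc := fun ξ η ζ => Subtype.ext (funext fun j => mul_assoc (ξ j) (η j) (ζ j))
    mul_comm := fun ξ η => Subtype.ext (funext fun j => mul_comm (ξ j) (η j)) }

instance [A.SubsetC0] : StarRing (KoetheSpace A) where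
  star ξ := ⟨fun j => star (ξ j), fun q => by simpa using ξ.2 q⟩
  star_involutive ξ := Subtype.ext (funext fun j => star_star (ξ j))
  star_mul ξ η := Subtype.ext (funext fun j => star_mul (ξ j) (η j))
  star_add ξ η := Subtype.ext (funext fun j => star_add (ξ j) (η j))

instance [A.SubsetC0] : StarModule ℂ (KoetheSpace A) where
  star_smul c ξ := Subtype.ext (funext fun j => star_smul c (ξ j))

instance [A.SubsetC0] : IsScalarTower ℂ (KoetheSpace A) (KoetheSpace A) where
  smul_assoc c ξ η := Subtype.ext (funext fun j => smul_assoc c (ξ j) (η j))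

instance [A.SubsetC0] : SMulCommClass ℂ (KoetheSpace A) (KoetheSpace A) where
  smul_comm c ξ η := Subtype.ext (funext fun j => smul_comm c (ξ j) (η j))

/-- The closed *-subalgebra of `λ^∞(A)` generated by `S`: the smallest closed *-subalgebra that
contains `S`. -/
def closedStarAdjoin [A.SubsetC0] (S : Set (KoetheSpace A)) :
    NonUnitalStarSubalgebra ℂ (KoetheSpace A) :=
  sInf {F | IsClosed (F : Set (KoetheSpace A)) ∧ S ⊆ F}

end KoetheSpace

/-! ### Families of blocks -/

/-- A sequence of finite nonempty pairwise disjoint sets of natural numbers. -/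
structure BlockFamily where
  block : ℕ → Finset ℕ
  nonempty : ∀ k, (block k).Nonempty
  disjoint : ∀ k l, k ≠ l → Disjoint (block k) (block l)

namespace KoetheMatrix

/-- The Köthe matrix `(max_{j ∈ N k} a j q)` with row index `k` and column index `q`. -/
def blockMax (A : KoetheMatrix) (N : BlockFamily) : KoetheMatrix where
  a k q := (N.block k).sup' (N.nonempty k) (fun j => A.a j q)
  nonneg k q := by
    obtain ⟨j, hj⟩ := N.nonempty k
    exact (A.nonneg j q).trans (Finset.le_sup' (fun j => A.a j q) hj)
  exists_pos k := by
    obtain ⟨j, hj⟩ := N.nonempty k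
    obtain ⟨q, hq⟩ := A.exists_pos j
    exact ⟨q, hq.trans_le (Finset.le_sup' (fun j => A.a j q) hj)⟩
  mono k q := Finset.sup'_mono_fun fun j _ => A.mono j q

/-- If `λ^∞(A)` is contained in `c_0`, then so is `λ^∞(max_{j ∈ N k} a j q)`, which therefore is a
*-algebra under the pointwise operations. -/
instance (A : KoetheMatrix) (N : BlockFamily) [A.SubsetC0] : (A.blockMax N).SubsetC0 where
  tendsto_zero η := by
    classical
    choose m hm using N.nonempty
    have hinj : Function.Injective m := by
      intro k l hkl
      by_contra hne
      exact Finset.disjoint_left.1 (N.disjoint k l hne) (hm k) (hkl ▸ hm l)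
    have hmem : Function.extend m η 0 ∈ A.submodule := by
      intro q
      obtain ⟨C, hC⟩ := η.2 q
      refine ⟨max C 0, ?_⟩
      rintro _ ⟨j, rfl⟩
      by_cases hj : ∃ k, m k = j
      · obtain ⟨k, rfl⟩ := hj
        have h1 : ‖η k‖ * (A.blockMax N).a k q ≤ C := hC ⟨k, rfl⟩
        have h2 : A.a (m k) q ≤ (A.blockMax N).a k q :=
          Finset.le_sup' (fun j => A.a j q) (hm k)
        simp only [hinj.extend_apply]
        exact ((mul_le_mul_of_nonneg_left h2 (norm_nonneg _)).trans h1).trans (le_max_left _ _)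
      · simp [Function.extend_apply' _ _ _ hj]
    have ht := (SubsetC0.tendsto_zero (⟨_, hmem⟩ : KoetheSpace A)).comp
      hinj.nat_tendsto_atTop
    refine ht.congr fun k => ?_
    exact hinj.extend_apply _ _ k

end KoetheMatrix

/-- The *-subalgebra `E` of `λ^∞(A)` contains the sequences `e_{N k}`, they form a Schauder basis
of `E`, and there is an isomorphism of Fréchet *-algebras (a *-algebra isomorphism which is a
homeomorphism) from `E` onto `λ^∞(max_{j ∈ N k} a j q)` with `e_{N k} ↦ e_k`. -/
def HasBlockBasis {A : KoetheMatrix} [A.SubsetC0]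
    (E : NonUnitalStarSubalgebra ℂ (KoetheSpace A)) (N : BlockFamily) : Prop :=
  ∃ e : ℕ → E, (∀ k, (e k : KoetheSpace A) = KoetheSpace.indicator A (N.block k)) ∧
    IsSchauderBasis e ∧
    ∃ Φ : E ≃⋆ₐ[ℂ] KoetheSpace (A.blockMax N), Continuous Φ ∧ Continuous Φ.symm ∧
      ∀ k, Φ (e k) = KoetheSpace.indicator (A.blockMax N) {k}

end

/-! ### Coordinates, seminorms and the consequence of nuclearity -/

namespace KoetheSpace

variable {A : KoetheMatrix}

/-! Nuclearity makes the weighted coordinates `‖ξ j‖ * A.a j q` of every element tend to zero for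
each `q` (`finite_le_of_isNuclearSpace`); the proof bounds their sum. Hence a sequence that is
constant on blocks and vanishes off them is the limit of its finite block sums. Its seminorms are
weighted suprema, so passing to the sequence of block values replaces the weights on a block by
their maximum and preserves each seminorm.

Both halves then reduce to one criterion, `hasBlockBasis_of_le_blockSubalgebra`: `E` is closed,
contains the block indicators, and lies inside `blockSubalgebra`. Such an `E` must be all of
`blockSubalgebra`. For the closed *-subalgebra generated by the indicators this is immediate.

For a given `E`, call two coordinates inseparable if all elements of `E` agree on them, and take as
blocks the classes on which `E` does not vanish. They are finite because elements of `E` are null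
sequences, and infinitely many because otherwise `E` would be finite-dimensional. The remaining
point is `indicator_mem_of_isClosed`. Pick `ξ` and `η` in `E` equal to 1 on the class `C`, with `η`
zero at the finitely many points outside `C` where `‖ξ k‖ ≥ 1/2`. Then `ξ ^ m * η` converges to the
indicator of `C` at the rate `2⁻ᵐ` in every seminorm. -/

@[simp] theorem add_apply (ξ η : KoetheSpace A) (j : ℕ) : (ξ + η) j = ξ j + η j := rfl
@[simp] theorem sub_apply (ξ η : KoetheSpace A) (j : ℕ) : (ξ - η) j = ξ j - η j := rfl
@[simp] theorem smul_apply (c : ℂ) (ξ : KoetheSpace A) (j : ℕ) : (c • ξ) j = c * ξ j := rfl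
@[simp] theorem mul_apply [A.SubsetC0] (ξ η : KoetheSpace A) (j : ℕ) :
    (ξ * η) j = ξ j * η j := rfl
@[simp] theorem star_apply [A.SubsetC0] (ξ : KoetheSpace A) (j : ℕ) :
    (star ξ) j = star (ξ j) := rfl
@[simp] theorem indicator_apply (N : Finset ℕ) (j : ℕ) :
    indicator A N j = if j ∈ N then 1 else 0 := rfl

@[ext] theorem ext {ξ η : KoetheSpace A} (h : ∀ j, ξ j = η j) : ξ = η :=
  Subtype.ext (funext h)

/-- Evaluation at the `j`-th coordinate. -/
def evalLinear (A : KoetheMatrix) (j : ℕ) : KoetheSpace A →ₗ[ℂ] ℂ where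
  toFun ξ := ξ j
  map_add' _ _ := rfl
  map_smul' _ _ := rfl

@[simp] theorem sum_apply {ι : Type*} (s : Finset ι) (f : ι → KoetheSpace A) (j : ℕ) :
    (∑ i ∈ s, f i) j = ∑ i ∈ s, f i j :=
  map_sum (evalLinear A j) f s

theorem le_seminorm (ξ : KoetheSpace A) (q j : ℕ) : ‖ξ j‖ * A.a j q ≤ seminorm A q ξ :=
  le_ciSup (ξ.2 q) j

theorem seminorm_le {ξ : KoetheSpace A} {q : ℕ} {C : ℝ} (h : ∀ j, ‖ξ j‖ * A.a j q ≤ C) :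
    seminorm A q ξ ≤ C :=
  ciSup_le h

/-- Some weight of each row is positive, and the corresponding seminorm dominates the coordinate up
to the inverse of that weight. -/
theorem continuous_eval (j : ℕ) : Continuous fun ξ : KoetheSpace A => ξ j := by
  obtain ⟨q, hq⟩ := A.exists_pos j
  have : Continuous (evalLinear A j) := by
    refine WithSeminorms.continuous_of_continuous_comp (norm_withSeminorms ℂ ℂ) _ fun _ => ?_
    refine Seminorm.continuous_of_le (q := (Real.toNNReal (A.a j q)⁻¹) • seminorm A q) ?_ ?_
    · exact ((withSeminorms A).continuous_seminorm q).const_smul (Real.toNNReal (A.a j q)⁻¹)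
    · intro ξ
      have h := le_seminorm ξ q j
      change ‖ξ j‖ ≤ (Real.toNNReal (A.a j q)⁻¹ : ℝ) * seminorm A q ξ
      rw [Real.coe_toNNReal _ (inv_nonneg.2 hq.le), inv_mul_eq_div, le_div_iff₀ hq]
      exact h
  exact this

/-- In a nuclear Köthe space the weighted coordinates of every element tend to zero. -/
theorem finite_le_of_isNuclearSpace (hA : IsNuclearSpace (KoetheSpace A)) (ξ : KoetheSpace A)
    (q : ℕ) {ε : ℝ} (hε : 0 < ε) : {j | ε ≤ ‖ξ j‖ * A.a j q}.Finite := by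
  obtain ⟨p, hp, -, f, c, y, hf, hc, hy⟩ :=
    hA (seminorm A q) ((withSeminorms A).continuous_seminorm q)
  obtain ⟨s, C, -, hs⟩ := Seminorm.bound_of_continuous (withSeminorms A) p hp
  set D : ℝ := C * (s.sup (seminorm A)) ξ with hD
  -- The seminorms are solid: they only see absolute values of coordinates. So one constant `D`
  -- bounds `p` on everything dominated by `ξ`.
  have hpD : ∀ η : KoetheSpace A, (∀ j, ‖η j‖ ≤ ‖ξ j‖) → p η ≤ D := by
    intro η hη
    refine (hs η).trans (mul_le_mul_of_nonneg_left ?_ C.2)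
    refine Seminorm.finset_sup_apply_le (apply_nonneg _ _) fun i hi => ?_
    refine le_trans ?_ (Seminorm.le_finset_sup_apply (p := seminorm A) (x := ξ) hi)
    exact seminorm_le fun j => (mul_le_mul_of_nonneg_right (hη j) (A.nonneg j i)).trans
      (le_seminorm ξ i j)
  set x : ℕ → KoetheSpace A := fun j => ξ j • indicator A {j} with hx
  -- Choosing phases turns the sum of absolute values into `f n` of a single vector dominated by
  -- `ξ`. The bound is therefore independent of `F`.
  have hsum : ∀ (n : ℕ) (F : Finset ℕ), ∑ j ∈ F, ‖f n (x j)‖ ≤ c n * D := by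
    intro n F
    have hsign : ∀ z : ℂ, ∃ u : ℂ, ‖u‖ ≤ 1 ∧ u * z = (‖z‖ : ℂ) := by
      intro z
      by_cases hz : z = 0
      · exact ⟨0, by simp, by simp [hz]⟩
      · have hz' : ‖z‖ ≠ 0 := norm_ne_zero_iff.2 hz
        refine ⟨‖z‖ / z, ?_, by field_simp⟩
        simp [hz']
    choose u hu1 hu2 using hsign
    set η : KoetheSpace A := ∑ j ∈ F, u (f n (x j)) • x j with hη
    have h1 : f n η = ((∑ j ∈ F, ‖f n (x j)‖ : ℝ) : ℂ) := by
      simp only [hη, map_sum, map_smul, smul_eq_mul, hu2, Complex.ofReal_sum]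
    have h2 : p η ≤ D := by
      refine hpD η fun i => ?_
      have : η i = if i ∈ F then u (f n (x i)) * ξ i else 0 := by
        simp [hη, hx]
      rw [this]
      split_ifs
      · rw [norm_mul]
        exact mul_le_of_le_one_left (norm_nonneg _) (hu1 _)
      · simp
    have h3 : ‖f n η‖ = ∑ j ∈ F, ‖f n (x j)‖ := by
      rw [h1, Complex.norm_real, Real.norm_of_nonneg]
      exact Finset.sum_nonneg fun _ _ => norm_nonneg _
    rw [← h3]
    exact (hf n η).trans (mul_le_mul_of_nonneg_left h2 (c n).2)
  have hnorm : ∀ j, ‖Seminorm.LocalSpace.toBanach (seminorm A q) (x j)‖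
      = seminorm A q (x j) := fun j => UniformSpace.Completion.norm_coe _
  have hterm : ∀ j n, ‖f n (x j) • y n‖ ≤ (c n * ‖y n‖) * D := by
    intro j n
    have := hsum n {j}
    rw [Finset.sum_singleton] at this
    rw [norm_smul]
    calc _ ≤ (c n * D) * ‖y n‖ := mul_le_mul_of_nonneg_right this (norm_nonneg _)
      _ = _ := by ring
  have hsummable : ∀ j, Summable fun n => ‖f n (x j) • y n‖ := fun j =>
    Summable.of_nonneg_of_le (fun _ => norm_nonneg _) (hterm j) (hc.mul_right D)
  -- Expanding each `x j` by the nuclear representation and exchanging the sums bounds the total of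
  -- the seminorms of the `x j` over `F`, uniformly in `F`. Too many coordinates of size at least
  -- `ε` would exceed that bound.
  have hcard : ∀ F : Finset ℕ, (∀ j ∈ F, ε ≤ ‖ξ j‖ * A.a j q) →
      (F.card : ℝ) * ε ≤ (∑' n, (c n : ℝ) * ‖y n‖) * D := by
    intro F hF
    have h1 : ∀ j ∈ F, ε ≤ ∑' n, ‖f n (x j) • y n‖ := by
      intro j hj
      have h := le_seminorm (x j) q j
      have hxj : x j j = ξ j := by simp [hx]
      rw [hxj, ← hnorm j, ← (hy (x j)).tsum_eq] at h
      exact (hF j hj).trans (h.trans (norm_tsum_le_tsum_norm (hsummable j)))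
    calc (F.card : ℝ) * ε = ∑ j ∈ F, ε := by simp
      _ ≤ ∑ j ∈ F, ∑' n, ‖f n (x j) • y n‖ := Finset.sum_le_sum h1
      _ = ∑' n, ∑ j ∈ F, ‖f n (x j) • y n‖ :=
        (Summable.tsum_finsetSum fun j _ => hsummable j).symm
      _ ≤ ∑' n, (c n : ℝ) * ‖y n‖ * D := by
        refine Summable.tsum_le_tsum (fun n => ?_) (summable_sum fun j _ => hsummable j)
          (hc.mul_right D)
        simp only [norm_smul, ← Finset.sum_mul]
        calc _ ≤ (c n * D) * ‖y n‖ := mul_le_mul_of_nonneg_right (hsum n F) (norm_nonneg _)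
          _ = _ := by ring
      _ = _ := tsum_mul_right
  by_contra hinf
  obtain ⟨m, hm⟩ := exists_nat_gt ((∑' n, (c n : ℝ) * ‖y n‖) * D / ε)
  obtain ⟨F, hF, hFm⟩ := Set.Infinite.exists_subset_card_eq hinf m
  have := hcard F fun j hj => hF hj
  rw [hFm] at this
  rw [div_lt_iff₀ hε] at hm
  linarith

end KoetheSpace

/-! ### Representatives of blocks -/

namespace BlockFamily

theorem eq_of_mem (N : BlockFamily) {j k l : ℕ} (hk : j ∈ N.block k) (hl : j ∈ N.block l) :
    k = l := by
  by_contra hne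
  exact Finset.disjoint_left.1 (N.disjoint k l hne) hk hl

/-- A chosen element of the `k`-th block. -/
noncomputable def rep (N : BlockFamily) (k : ℕ) : ℕ := (N.nonempty k).choose

theorem rep_mem (N : BlockFamily) (k : ℕ) : N.rep k ∈ N.block k := (N.nonempty k).choose_spec

theorem rep_mem_iff (N : BlockFamily) {k l : ℕ} : N.rep k ∈ N.block l ↔ k = l :=
  ⟨fun h => N.eq_of_mem (N.rep_mem k) h, fun h => h ▸ N.rep_mem k⟩

end BlockFamily

/-! ### Sequences constant on blocks, and the block basis criterion -/

namespace KoetheSpace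

variable {A : KoetheMatrix}

/-- The sequences which are constant on each block and vanish outside of the blocks. -/
def blockSubalgebra (A : KoetheMatrix) [A.SubsetC0] (N : BlockFamily) :
    NonUnitalStarSubalgebra ℂ (KoetheSpace A) where
  carrier := {ξ | (∀ k, ∀ i ∈ N.block k, ∀ j ∈ N.block k, ξ i = ξ j) ∧
    ∀ j, (∀ k, j ∉ N.block k) → ξ j = 0}
  add_mem' := fun {ξ η} hξ hη => ⟨fun k i hi j hj => by
    simp [hξ.1 k i hi j hj, hη.1 k i hi j hj], fun j hj => by simp [hξ.2 j hj, hη.2 j hj]⟩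
  zero_mem' := ⟨fun _ _ _ _ _ => rfl, fun _ _ => rfl⟩
  mul_mem' := fun {ξ η} hξ hη => ⟨fun k i hi j hj => by
    simp [hξ.1 k i hi j hj, hη.1 k i hi j hj], fun j hj => by simp [hξ.2 j hj]⟩
  smul_mem' := fun c ξ hξ => ⟨fun k i hi j hj => by
    simp [hξ.1 k i hi j hj], fun j hj => by simp [hξ.2 j hj]⟩
  star_mem' := fun {ξ} hξ => ⟨fun k i hi j hj => by
    simp [hξ.1 k i hi j hj], fun j hj => by simp [hξ.2 j hj]⟩

theorem isClosed_blockSubalgebra [A.SubsetC0] (N : BlockFamily) :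
    IsClosed (blockSubalgebra A N : Set (KoetheSpace A)) := by
  have : (blockSubalgebra A N : Set (KoetheSpace A)) =
      {ξ | ∀ k, ∀ i ∈ N.block k, ∀ j ∈ N.block k, ξ i = ξ j} ∩
        {ξ | ∀ j, (∀ k, j ∉ N.block k) → ξ j = 0} := rfl
  rw [this]
  refine IsClosed.inter ?_ ?_
  · simp only [Set.ofPred_forall]
    exact isClosed_iInter fun k => isClosed_iInter fun i => isClosed_iInter fun _ =>
      isClosed_iInter fun j => isClosed_iInter fun _ =>
        isClosed_eq (continuous_eval i) (continuous_eval j)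
  · simp only [Set.ofPred_forall]
    exact isClosed_iInter fun j => isClosed_iInter fun _ =>
      isClosed_eq (continuous_eval j) continuous_const

theorem indicator_mem_blockSubalgebra [A.SubsetC0] (N : BlockFamily) (k : ℕ) :
    indicator A (N.block k) ∈ blockSubalgebra A N := by
  refine ⟨fun l i hi j hj => ?_, fun j hj => by simp [hj k]⟩
  have h : ∀ i ∈ N.block l, (i ∈ N.block k ↔ l = k) := fun i hi =>
    ⟨fun h => N.eq_of_mem hi h, fun h => h ▸ hi⟩
  simp [h i hi, h j hj]

/-- The maximal weight is attained at some point of the block, where `ξ` has the same value as at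
the representative. With `norm_blockExtendFun_mul_le` this shows that block values preserve every
seminorm. -/
theorem norm_rep_mul_blockMax_le [A.SubsetC0] {N : BlockFamily} {ξ : KoetheSpace A}
    (hξ : ξ ∈ blockSubalgebra A N) (k q : ℕ) :
    ‖ξ (N.rep k)‖ * (A.blockMax N).a k q ≤ seminorm A q ξ := by
  obtain ⟨j, hj, h⟩ := Finset.exists_mem_eq_sup' (N.nonempty k) (fun j => A.a j q)
  have h' : (A.blockMax N).a k q = A.a j q := h
  rw [h', hξ.1 k _ (N.rep_mem k) j hj]
  exact le_seminorm ξ q j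

/-- The sequence of values on the blocks of a sequence which is constant on each block. -/
noncomputable def blockValues [A.SubsetC0] (N : BlockFamily) (ξ : KoetheSpace A)
    (hξ : ξ ∈ blockSubalgebra A N) : KoetheSpace (A.blockMax N) :=
  ⟨fun k => ξ (N.rep k), fun q => ⟨seminorm A q ξ, by
    rintro _ ⟨k, rfl⟩
    exact norm_rep_mul_blockMax_le hξ k q⟩⟩

@[simp] theorem blockValues_apply [A.SubsetC0] (N : BlockFamily) (ξ : KoetheSpace A)
    (hξ : ξ ∈ blockSubalgebra A N) (k : ℕ) : blockValues N ξ hξ k = ξ (N.rep k) := rfl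

open Classical in
/-- The sequence which on the `k`-th block takes the value `η k`. -/
noncomputable def blockExtendFun (N : BlockFamily) (η : ℕ → ℂ) (j : ℕ) : ℂ :=
  if h : ∃ k, j ∈ N.block k then η h.choose else 0

theorem blockExtendFun_of_mem (N : BlockFamily) (η : ℕ → ℂ) {j k : ℕ} (h : j ∈ N.block k) :
    blockExtendFun N η j = η k := by
  have h' : ∃ k, j ∈ N.block k := ⟨k, h⟩
  rw [blockExtendFun, dif_pos h', N.eq_of_mem h'.choose_spec h]

theorem blockExtendFun_of_notMem (N : BlockFamily) (η : ℕ → ℂ) {j : ℕ}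
    (h : ∀ k, j ∉ N.block k) : blockExtendFun N η j = 0 := by
  rw [blockExtendFun, dif_neg (by simpa using h)]

theorem norm_blockExtendFun_mul_le (N : BlockFamily) (η : KoetheSpace (A.blockMax N)) (j q : ℕ) :
    ‖blockExtendFun N η j‖ * A.a j q ≤ seminorm (A.blockMax N) q η := by
  by_cases h : ∃ k, j ∈ N.block k
  · obtain ⟨k, hk⟩ := h
    rw [blockExtendFun_of_mem N η hk]
    exact (mul_le_mul_of_nonneg_left (Finset.le_sup' (fun j => A.a j q) hk)
      (norm_nonneg _)).trans (le_seminorm η q k)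
  · rw [blockExtendFun_of_notMem N η (by simpa using h)]
    simp [apply_nonneg]

/-- The linear map which sends `η` to the sequence with the value `η k` on the `k`-th block. -/
noncomputable def blockExtend (A : KoetheMatrix) (N : BlockFamily) :
    KoetheSpace (A.blockMax N) →ₗ[ℂ] KoetheSpace A where
  toFun η := ⟨blockExtendFun N η, fun q => ⟨seminorm (A.blockMax N) q η, by
    rintro _ ⟨j, rfl⟩
    exact norm_blockExtendFun_mul_le N η j q⟩⟩
  map_add' η ζ := by
    ext j
    change blockExtendFun N (η + ζ : KoetheSpace (A.blockMax N)) j =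
      blockExtendFun N η j + blockExtendFun N ζ j
    unfold blockExtendFun
    split_ifs <;> simp
  map_smul' c η := by
    ext j
    change blockExtendFun N (c • η : KoetheSpace (A.blockMax N)) j = c * blockExtendFun N η j
    unfold blockExtendFun
    split_ifs <;> simp

theorem blockExtend_of_mem (N : BlockFamily) (η : KoetheSpace (A.blockMax N)) {j k : ℕ}
    (h : j ∈ N.block k) : blockExtend A N η j = η k :=
  blockExtendFun_of_mem N η h

theorem blockExtend_of_notMem (N : BlockFamily) (η : KoetheSpace (A.blockMax N)) {j : ℕ}
    (h : ∀ k, j ∉ N.block k) : blockExtend A N η j = 0 :=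
  blockExtendFun_of_notMem N η h

theorem continuous_blockExtend (N : BlockFamily) : Continuous (blockExtend A N) := by
  refine WithSeminorms.continuous_of_continuous_comp (withSeminorms A) _ fun q => ?_
  refine Seminorm.continuous_of_le ((withSeminorms (A.blockMax N)).continuous_seminorm q) ?_
  exact fun η => seminorm_le fun j => norm_blockExtendFun_mul_le N η j q

theorem blockExtend_mem [A.SubsetC0] (N : BlockFamily) (η : KoetheSpace (A.blockMax N)) :
    blockExtend A N η ∈ blockSubalgebra A N :=
  ⟨fun k i hi j hj => by rw [blockExtend_of_mem N η hi, blockExtend_of_mem N η hj],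
    fun j hj => blockExtend_of_notMem N η hj⟩

theorem blockExtend_blockValues [A.SubsetC0] (N : BlockFamily) (ξ : KoetheSpace A)
    (hξ : ξ ∈ blockSubalgebra A N) : blockExtend A N (blockValues N ξ hξ) = ξ := by
  ext j
  by_cases h : ∃ k, j ∈ N.block k
  · obtain ⟨k, hk⟩ := h
    rw [blockExtend_of_mem N _ hk, blockValues_apply]
    exact hξ.1 k _ (N.rep_mem k) j hk
  · push Not at h
    rw [blockExtend_of_notMem N _ h, hξ.2 j h]

theorem sum_smul_indicator_of_mem (N : BlockFamily) (c : ℕ → ℂ) (n : ℕ) {j k : ℕ}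
    (h : j ∈ N.block k) :
    (∑ l ∈ Finset.range n, c l • indicator A (N.block l)) j = if k < n then c k else 0 := by
  have h' : ∀ l, (j ∈ N.block l ↔ k = l) := fun l =>
    ⟨fun hl => N.eq_of_mem h hl, fun hl => hl ▸ h⟩
  simp [h']

theorem sum_smul_indicator_of_notMem (N : BlockFamily) (c : ℕ → ℂ) (n : ℕ) {j : ℕ}
    (h : ∀ k, j ∉ N.block k) :
    (∑ l ∈ Finset.range n, c l • indicator A (N.block l)) j = 0 := by
  simp [h]

/-- A sequence which is constant on each block has the expansion `∑ ξ (N.rep k) • e_{N k}`. -/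
theorem tendsto_sum_smul_indicator [A.SubsetC0] (hA : IsNuclearSpace (KoetheSpace A))
    (N : BlockFamily) {ξ : KoetheSpace A} (hξ : ξ ∈ blockSubalgebra A N) :
    Tendsto (fun n => ∑ k ∈ Finset.range n, ξ (N.rep k) • indicator A (N.block k)) atTop
      (𝓝 ξ) := by
  rw [(withSeminorms A).tendsto_nhds]
  intro q ε hε
  have hfin := finite_le_of_isNuclearSpace hA ξ q (half_pos hε)
  have hev : ∀ j, ∀ᶠ n in atTop, ∀ k, j ∈ N.block k → k < n := by
    intro j
    by_cases h : ∃ k, j ∈ N.block k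
    · obtain ⟨k, hk⟩ := h
      filter_upwards [eventually_gt_atTop k] with n hn l hl
      rwa [← N.eq_of_mem hk hl]
    · push Not at h
      exact Eventually.of_forall fun n k hk => absurd hk (h k)
  filter_upwards [(hfin.eventually_all).2 fun j _ => hev j] with n hn
  -- A supremum of strict bounds is only bounded weakly, hence `ε / 2`. Every coordinate of size at
  -- least `ε / 2` already lies in the partial sum.
  refine lt_of_le_of_lt (seminorm_le (C := ε / 2) fun j => ?_) (half_lt_self hε)
  rw [sub_apply]
  by_cases h : ∃ k, j ∈ N.block k
  · obtain ⟨k, hk⟩ := h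
    rw [sum_smul_indicator_of_mem N _ n hk, hξ.1 k _ (N.rep_mem k) j hk]
    split_ifs with hkn
    · simpa using (half_pos hε).le
    · rw [zero_sub, norm_neg]
      by_contra hlt
      exact hkn (hn j (not_le.1 hlt).le k hk)
  · push Not at h
    rw [sum_smul_indicator_of_notMem N _ n h, hξ.2 j h]
    simpa using (half_pos hε).le

/-- A closed *-subalgebra which contains the indicators of the blocks and whose elements are
constant on the blocks has the block basis. -/
theorem hasBlockBasis_of_le_blockSubalgebra [A.SubsetC0] (hA : IsNuclearSpace (KoetheSpace A))
    (N : BlockFamily) (E : NonUnitalStarSubalgebra ℂ (KoetheSpace A))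
    (hE : IsClosed (E : Set (KoetheSpace A))) (hmem : ∀ k, indicator A (N.block k) ∈ E)
    (hle : E ≤ blockSubalgebra A N) : HasBlockBasis E N := by
  -- This gives surjectivity onto the model space: every block-constant sequence is a limit of
  -- combinations of indicators, so it lies in the closed set `E`.
  have hext : ∀ η, blockExtend A N η ∈ E := fun η =>
    hE.mem_of_tendsto (tendsto_sum_smul_indicator hA N (blockExtend_mem N η))
      (Eventually.of_forall fun n => sum_mem fun k _ => SMulMemClass.smul_mem _ (hmem k))
  have hcoe : ∀ (c : ℕ → ℂ) (n : ℕ),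
      ((∑ k ∈ Finset.range n, c k • (⟨indicator A (N.block k), hmem k⟩ : E) : E) : KoetheSpace A)
        = ∑ k ∈ Finset.range n, c k • indicator A (N.block k) := fun c n => by
    simp
  have htends : ∀ x : E, Tendsto (fun n => ∑ k ∈ Finset.range n,
      (x : KoetheSpace A) (N.rep k) • (⟨indicator A (N.block k), hmem k⟩ : E)) atTop (𝓝 x) := by
    intro x
    rw [tendsto_subtype_rng]
    simp only [hcoe]
    exact tendsto_sum_smul_indicator hA N (hle x.2)
  have hgrp : IsTopologicalAddGroup E :=
    Topology.IsInducing.topologicalAddGroup (NonUnitalSubalgebraClass.subtype E)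
      Topology.IsInducing.subtypeVal
  let Φ : E ≃⋆ₐ[ℂ] KoetheSpace (A.blockMax N) :=
    { toFun := fun x => blockValues N x (hle x.2)
      invFun := fun η => ⟨blockExtend A N η, hext η⟩
      left_inv := fun x => Subtype.ext (blockExtend_blockValues N x (hle x.2))
      right_inv := fun η => by
        ext k
        exact blockExtend_of_mem N η (N.rep_mem k)
      map_mul' := fun _ _ => rfl
      map_add' := fun _ _ => rfl
      map_star' := fun _ => rfl
      map_smul' := fun _ _ => rfl }
  -- The linear map underlying `Φ`, in the form required by the seminorm criterion for continuity.
  let Ψ : E →ₗ[ℂ] KoetheSpace (A.blockMax N) :=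
    { toFun := fun x => blockValues N x (hle x.2)
      map_add' := fun _ _ => rfl
      map_smul' := fun _ _ => rfl }
  have hΨ : Continuous Ψ := by
    refine WithSeminorms.continuous_of_continuous_comp (withSeminorms _) _ fun q => ?_
    refine Seminorm.continuous_of_le
      (q := (seminorm A q).comp (NonUnitalSubalgebraClass.subtype E : E →ₗ[ℂ] KoetheSpace A))
      (((withSeminorms A).continuous_seminorm q).comp continuous_subtype_val) ?_
    exact fun x => seminorm_le fun k => norm_rep_mul_blockMax_le (hle x.2) k q
  refine ⟨fun k => ⟨indicator A (N.block k), hmem k⟩, fun k => rfl, ⟨fun x => ?_, ?_⟩, Φ, hΨ,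
    (continuous_blockExtend N).subtype_mk hext, fun k => ?_⟩
  · refine ⟨fun k => (x : KoetheSpace A) (N.rep k), htends x, fun c hc => funext fun k => ?_⟩
    -- Evaluation at the representative of block `k` is continuous and sends the partial sums to `c
    -- k` once `n > k`, which forces the coefficient.
    have h1 := ((continuous_eval (N.rep k)).comp continuous_subtype_val).continuousAt.tendsto.comp
      hc
    refine tendsto_nhds_unique (tendsto_const_nhds.congr' ?_) h1
    filter_upwards [eventually_gt_atTop k] with n hn
    simp only [Function.comp_apply, hcoe]
    rw [sum_smul_indicator_of_mem N c n (N.rep_mem k), if_pos hn]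
  · exact ⟨fun k => ⟨(evalLinear A (N.rep k)).comp
      (NonUnitalSubalgebraClass.subtype E : E →ₗ[ℂ] KoetheSpace A),
      (continuous_eval (N.rep k)).comp continuous_subtype_val⟩, htends⟩
  · ext l
    change (if N.rep l ∈ N.block k then (1 : ℂ) else 0) = if l ∈ ({k} : Finset ℕ) then 1 else 0
    simp [N.rep_mem_iff]

/-- `blockSubalgebra` is itself a closed *-subalgebra containing the generators, so it contains the
smallest one. -/
theorem hasBlockBasis_closedStarAdjoin [A.SubsetC0] (hA : IsNuclearSpace (KoetheSpace A))
    (N : BlockFamily) :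
    HasBlockBasis (closedStarAdjoin (Set.range fun k => indicator A (N.block k))) N := by
  refine hasBlockBasis_of_le_blockSubalgebra hA N _ ?_ (fun k => ?_) ?_
  · rw [closedStarAdjoin, NonUnitalStarAlgebra.coe_sInf]
    exact isClosed_biInter fun F hF => hF.1
  · rw [closedStarAdjoin, NonUnitalStarAlgebra.mem_sInf]
    exact fun F hF => hF.2 ⟨k, rfl⟩
  · refine sInf_le ⟨isClosed_blockSubalgebra N, ?_⟩
    rintro _ ⟨k, rfl⟩
    exact indicator_mem_blockSubalgebra N k

end KoetheSpace

/-! ### The blocks of a closed *-subalgebra -/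

namespace KoetheSpace

variable {A : KoetheMatrix} [A.SubsetC0]

theorem finite_le_norm (ξ : KoetheSpace A) {ε : ℝ} (hε : 0 < ε) : {k | ε ≤ ‖ξ k‖}.Finite := by
  have h := (KoetheMatrix.SubsetC0.tendsto_zero ξ).norm
  rw [norm_zero] at h
  have h' := h.eventually_lt_const hε
  rw [← Nat.cofinite_eq_atTop, eventually_cofinite] at h'
  simpa using h'

/-- If the finitely many coordinates in `K` can be separated from the `j`-th one by elements of
`E`, then some element of `E` vanishes on `K` but not at `j`. -/
theorem exists_mem_eq_zero_on (E : NonUnitalStarSubalgebra ℂ (KoetheSpace A)) {j : ℕ}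
    (hj : ∃ ξ ∈ E, ξ j ≠ 0) (K : Finset ℕ) (hK : ∀ k ∈ K, ∃ ξ ∈ E, ξ k ≠ ξ j) :
    ∃ η ∈ E, η j ≠ 0 ∧ ∀ k ∈ K, η k = 0 := by
  induction K using Finset.induction_on with
  | empty =>
    obtain ⟨ξ, hξ, h⟩ := hj
    exact ⟨ξ, hξ, h, by simp⟩
  | insert k K _ ih =>
    obtain ⟨η, hη, hηj, hηK⟩ := ih fun i hi => hK i (Finset.mem_insert_of_mem hi)
    obtain ⟨ζ, hζ, hne⟩ := hK k (Finset.mem_insert_self k K)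
    -- This is `η * (ζ - ζ k)` written without a unit: it keeps the zeros of `η`, adds one at `k`,
    -- and stays nonzero at `j`.
    refine ⟨η * ζ - ζ k • η, sub_mem (MulMemClass.mul_mem hη hζ) (SMulMemClass.smul_mem _ hη), ?_, ?_⟩
    · have : (η * ζ - ζ k • η) j = η j * (ζ j - ζ k) := by
        simp only [sub_apply, mul_apply, smul_apply]; ring
      rw [this]
      exact mul_ne_zero hηj (sub_ne_zero.2 hne.symm)
    · intro i hi
      rcases Finset.mem_insert.1 hi with rfl | hi
      · simp only [sub_apply, mul_apply, smul_apply]; ring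
      · simp [hηK i hi]

/-- A closed subalgebra contains the indicators of the sets of coordinates that it does not
separate, if it does not vanish there. -/
theorem indicator_mem_of_isClosed (E : NonUnitalStarSubalgebra ℂ (KoetheSpace A))
    (hE : IsClosed (E : Set (KoetheSpace A))) {j : ℕ} (hj : ∃ ξ ∈ E, ξ j ≠ 0) {C : Finset ℕ}
    (hC : ∀ k, k ∈ C ↔ ∀ ξ ∈ E, ξ k = ξ j) : indicator A C ∈ E := by
  obtain ⟨ξ, hξ, hξj⟩ : ∃ ξ ∈ E, ξ j = 1 := by
    obtain ⟨ξ, hξ, h⟩ := hj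
    exact ⟨(ξ j)⁻¹ • ξ, SMulMemClass.smul_mem _ hξ, by simp [h]⟩
  have hfin := finite_le_norm ξ (one_half_pos (α := ℝ))
  obtain ⟨η, hη, hηj, hηK⟩ : ∃ η ∈ E, η j = 1 ∧ ∀ k, k ∉ C → 1 / 2 ≤ ‖ξ k‖ → η k = 0 := by
    obtain ⟨η, hη, h, hK⟩ := exists_mem_eq_zero_on E hj (hfin.toFinset \ C) fun k hk => by
      simpa [hC] using (Finset.mem_sdiff.1 hk).2
    refine ⟨(η j)⁻¹ • η, SMulMemClass.smul_mem _ hη, by simp [h], fun k hkC hk => ?_⟩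
    simp [hK k (Finset.mem_sdiff.2 ⟨hfin.mem_toFinset.2 hk, hkC⟩)]
  -- The sequence `ξ ^ m * η`, written by iteration since there is no unit to serve as `ξ ^ 0`.
  let u : ℕ → KoetheSpace A := fun m => (fun ζ => ξ * ζ)^[m] η
  have hu : ∀ m, u (m + 1) = ξ * u m := fun m => Function.iterate_succ_apply' _ _ _
  have huE : ∀ m, u m ∈ E := by
    intro m
    induction m with
    | zero => exact hη
    | succ m ih => rw [hu]; exact MulMemClass.mul_mem hξ ih
  have huk : ∀ m k, u m k = ξ k ^ m * η k := by
    intro m k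
    induction m with
    | zero => simp [u]
    | succ m ih => rw [hu, mul_apply, ih]; ring
  refine hE.mem_of_tendsto (f := u) (b := atTop) ?_ (Eventually.of_forall huE)
  rw [(withSeminorms A).tendsto_nhds]
  intro q ε hε
  have hlim : Tendsto (fun m : ℕ => (1 / 2 : ℝ) ^ m * seminorm A q η) atTop (𝓝 0) := by
    simpa using (tendsto_pow_atTop_nhds_zero_of_lt_one (r := (1 / 2 : ℝ)) (by norm_num)
      (by norm_num)).mul_const (seminorm A q η)
  filter_upwards [hlim.eventually_lt_const hε] with m hm
  refine lt_of_le_of_lt (seminorm_le fun k => ?_) hm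
  rw [sub_apply, huk, indicator_apply]
  by_cases hk : k ∈ C
  · rw [(hC k).1 hk ξ hξ, (hC k).1 hk η hη, hξj, hηj]
    simp [hk]
  · rw [if_neg hk, sub_zero, norm_mul, norm_pow, mul_assoc]
    -- Outside `C` either `η` vanishes or the factor `ξ k ^ m` has modulus at most `2⁻ᵐ`.
    by_cases hk2 : 1 / 2 ≤ ‖ξ k‖
    · rw [hηK k hk hk2]
      simp
    · exact mul_le_mul (pow_le_pow_left₀ (norm_nonneg _) (not_le.1 hk2).le m)
        (le_seminorm η q k) (mul_nonneg (norm_nonneg _) (A.nonneg k q)) (by positivity)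

/-- The maximal sets of coordinates on which `E` is constant, but not zero. -/
def inseparableBlocks (E : NonUnitalStarSubalgebra ℂ (KoetheSpace A)) : Set (Finset ℕ) :=
  {C | ∃ j, (∃ ξ ∈ E, ξ j ≠ 0) ∧ ∀ k, k ∈ C ↔ ∀ ξ ∈ E, ξ k = ξ j}

theorem exists_mem_inseparableBlocks (E : NonUnitalStarSubalgebra ℂ (KoetheSpace A)) {j : ℕ}
    (hj : ∃ ξ ∈ E, ξ j ≠ 0) : ∃ C ∈ inseparableBlocks E, j ∈ C := by
  obtain ⟨ξ, hξ, h⟩ := id hj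
  -- A null sequence takes a nonzero value only finitely often.
  have hfin : {k | ∀ ξ ∈ E, ξ k = ξ j}.Finite :=
    (finite_le_norm ξ (norm_pos_iff.2 h)).subset fun k hk => by
      simp [hk ξ hξ]
  exact ⟨hfin.toFinset, ⟨j, hj, fun k => by simp⟩, by simp⟩

theorem nonempty_of_mem_inseparableBlocks {E : NonUnitalStarSubalgebra ℂ (KoetheSpace A)}
    {C : Finset ℕ} (hC : C ∈ inseparableBlocks E) : C.Nonempty := by
  obtain ⟨j, -, h⟩ := hC
  exact ⟨j, (h j).2 fun _ _ => rfl⟩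

theorem apply_eq_of_mem_inseparableBlocks {E : NonUnitalStarSubalgebra ℂ (KoetheSpace A)}
    {C : Finset ℕ} (hC : C ∈ inseparableBlocks E) {i k : ℕ} (hi : i ∈ C) (hk : k ∈ C)
    {ξ : KoetheSpace A} (hξ : ξ ∈ E) : ξ i = ξ k := by
  obtain ⟨j, -, h⟩ := hC
  rw [(h i).1 hi ξ hξ, (h k).1 hk ξ hξ]

theorem eq_of_mem_inseparableBlocks {E : NonUnitalStarSubalgebra ℂ (KoetheSpace A)}
    {C D : Finset ℕ} (hC : C ∈ inseparableBlocks E) (hD : D ∈ inseparableBlocks E) {i : ℕ}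
    (hiC : i ∈ C) (hiD : i ∈ D) : C = D := by
  obtain ⟨j, -, h⟩ := hC
  obtain ⟨l, -, h'⟩ := hD
  ext k
  rw [h, h']
  exact forall₂_congr fun ξ hξ => by rw [← (h i).1 hiC ξ hξ, (h' i).1 hiD ξ hξ]

/-- An element of `E` is determined by its values at one point of each block. With finitely many
blocks these evaluations would embed `E` in a finite-dimensional space. -/
theorem infinite_inseparableBlocks (E : NonUnitalStarSubalgebra ℂ (KoetheSpace A))
    (hE : ¬ FiniteDimensional ℂ E) : (inseparableBlocks E).Infinite := by
  intro hfin
  have := hfin.to_subtype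
  choose m hm using fun C : inseparableBlocks E => nonempty_of_mem_inseparableBlocks C.2
  let T : E →ₗ[ℂ] (inseparableBlocks E → ℂ) :=
    LinearMap.pi fun C => (evalLinear A (m C)).comp
      (NonUnitalSubalgebraClass.subtype E : E →ₗ[ℂ] KoetheSpace A)
  refine hE (FiniteDimensional.of_injective T ((injective_iff_map_eq_zero T).2 fun x hx => ?_))
  refine Subtype.ext (KoetheSpace.ext fun j => ?_)
  by_contra hj
  obtain ⟨C, hC, hjC⟩ := exists_mem_inseparableBlocks E ⟨x, x.2, hj⟩
  refine hj ((apply_eq_of_mem_inseparableBlocks hC hjC (hm ⟨C, hC⟩) x.2).trans ?_)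
  exact congrFun hx ⟨C, hC⟩

theorem exists_hasBlockBasis (hA : IsNuclearSpace (KoetheSpace A))
    (E : NonUnitalStarSubalgebra ℂ (KoetheSpace A)) (hE : IsClosed (E : Set (KoetheSpace A)))
    (hdim : ¬ FiniteDimensional ℂ E) : ∃ N : BlockFamily, HasBlockBasis E N := by
  have := (infinite_inseparableBlocks E hdim).to_subtype
  -- The blocks form an infinite set of finite subsets of `ℕ`, hence a countably infinite one, and
  -- can be enumerated without repetition.
  obtain ⟨hden⟩ := nonempty_denumerable (inseparableBlocks E)
  let b : ℕ ≃ inseparableBlocks E := (Denumerable.eqv _).symm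
  let N : BlockFamily :=
    { block := fun k => (b k : Finset ℕ)
      nonempty := fun k => nonempty_of_mem_inseparableBlocks (b k).2
      disjoint := fun k l hkl => Finset.disjoint_left.2 fun i hi hi' =>
        hkl (b.injective (Subtype.ext (eq_of_mem_inseparableBlocks (b k).2 (b l).2 hi hi'))) }
  refine ⟨N, hasBlockBasis_of_le_blockSubalgebra hA N E hE (fun k => ?_) fun ξ hξ => ?_⟩
  · obtain ⟨j, hj, h⟩ := (b k).2
    exact indicator_mem_of_isClosed E hE hj h
  · refine ⟨fun k i hi j hj => apply_eq_of_mem_inseparableBlocks (b k).2 hi hj hξ,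
      fun j hj => ?_⟩
    by_contra hne
    obtain ⟨C, hC, hjC⟩ := exists_mem_inseparableBlocks E ⟨ξ, hξ, hne⟩
    refine hj (b.symm ⟨C, hC⟩) ?_
    change j ∈ (b (b.symm ⟨C, hC⟩) : Finset ℕ)
    rwa [b.apply_symm_apply]

end KoetheSpace

theorem mainTheorem5 (A : KoetheMatrix) [A.SubsetC0] (hA : IsNuclearSpace (KoetheSpace A)) :
    (∀ E : NonUnitalStarSubalgebra ℂ (KoetheSpace A),
      IsClosed (E : Set (KoetheSpace A)) → ¬ FiniteDimensional ℂ E →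
        ∃ N : BlockFamily, HasBlockBasis E N) ∧
    (∀ N : BlockFamily,
      HasBlockBasis (KoetheSpace.closedStarAdjoin
        (Set.range fun k => KoetheSpace.indicator A (N.block k))) N) :=
  ⟨KoetheSpace.exists_hasBlockBasis hA, KoetheSpace.hasBlockBasis_closedStarAdjoin hA⟩
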